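/- Let $(\mathbf K,\otimes,\mathbf 1)$ be a compactly generated tensor triangulated category. That is: $\mathbf K$ is a triangulated category with a symmetric monoidal product that is exact in each variable; $\mathbf K$ has all set-indexed coproducts; the isomorphism classes of compact objects form a set, and every nonzero object receives a nonzero morphism from a compact object; $\mathbf 1$ is compact; and every compact object $M$ is rigid, with dual $M^*$. Here $C$ is compact if $\operatorname{Hom}_{\mathbf K}(C,-)$ commutes with set-indexed coproducts. Write $\Sigma$ for the shift and $\mathbf K^c$ for the full subcategory of compact objects. Let $X$ be a Zariski space, i.e. a Noetherian topological space in which every irreducible closed subset has a unique generic point. Let $\mathcal X$ be the collection of closed subsets of $X$, and $\mathcal X_{sp}$ the collection of specialization closed subsets, i.e. arbitrary unions of closed subsets. Let $V:\mathbf K^c\to\mathcal X$ be a support data, i.e. an assignment such that, for objects of $\mathbf K^c$: 1. $V(0)=\varnothing$ and $V(\mathbf 1)=X$; 2. $V(\bigoplus_{i\in I}M_i)=\bigcup_{i\in I}V(M_i)$ for every set $I$ for which $\bigoplus_{i\in I} M_i$ (formed in $\mathbf K$) is in $\mathbf K^c$; 3. $V(\Sigma M)=V(M)$; 4. $V(N)\subseteq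 V(M)\cup V(Q)$ for every distinguished triangle $M\to N\to Q\to\Sigma M$; 5. $V(M\otimes N)=V(M)\cap V(N)$; 6. $V(M^*)=V(M)$. Assume that $V$ is faithful: $V(M)=\varnothing$ if and only if $M= 0$. Assume also that there is an extension $\mathcal V:\mathbf K\to\mathcal X_{sp}$ of $V$, i.e. an assignment that satisfies 1–5 for all objects of $\mathbf K$, agrees with $V$ on $\mathbf K^c$, and is faithful on $\mathbf K$ if $V$ is faithful on $\mathbf K^c$. Then for every $M\in\mathbf K^c$, with $W=V(M)$, $$\{N\in\mathbf K^c \mid V(N)\subseteq W\}=\operatorname{Tensor}(M),$$ where $\operatorname{Tensor}(M)$ is the thick tensor ideal of $\mathbf K^c$ generated by $M$: the smallest triangulated subcategory of $\mathbf K^c$ that contains $M$ and is closed under direct summands and under tensoring with objects of $\mathbf K^c$. -/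

import Mathlib

open CategoryTheory Limits MonoidalCategory Pretriangulated

universe u v w

namespace TensorTriangular

section Spaces

variable (X : Type w) [TopologicalSpace X]

/-- A Zariski space: a Noetherian space in which every irreducible closed subset has a unique
generic point. -/
structure IsZariskiSpace : Prop where
  noetherian : TopologicalSpace.NoetherianSpace X
  existsUnique_genericPoint : ∀ Z : Set X, IsIrreducible Z → IsClosed Z →
    ∃! x : X, IsGenericPoint x Z

/-- The collection of closed subsets. -/
def closedSubsets : Set (Set X) := {Z | IsClosed Z}

/-- The collection of specialization closed subsets, i.e. of arbitrary unions of closed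
subsets. -/
def specializationClosedSubsets : Set (Set X) :=
  {W | ∃ 𝒵 : Set (Set X), (∀ Z ∈ 𝒵, IsClosed Z) ∧ W = ⋃₀ 𝒵}

end Spaces

section Categories

variable (K : Type u) [Category.{v} K]

section Compact

variable [Preadditive K]

open Classical in
/-- An object `C` is compact if `Hom(C, -)` commutes with set indexed coproducts: for every
coproduct of a family `Y` indexed by a set, the canonical map from `⨁ j, Hom(C, Y j)` to the
group of morphisms from `C` to the coproduct is bijective. -/
def compactObjects : ObjectProperty K := fun C =>
  ∀ (J : Type v) (Y : J → K) (c : Cofan Y), Nonempty (IsColimit c) →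
    Function.Bijective
      (DirectSum.toAddMonoid (fun j => Preadditive.rightComp C (c.inj j)) :
        (DirectSum J fun j => (C ⟶ Y j)) →+ (C ⟶ c.pt))

/-- The full subcategory of compact objects. -/
abbrev CompactSubcategory : Type u := (compactObjects K).FullSubcategory

/-- `K` has set indexed coproducts and is compactly generated: the isomorphism classes of compact
objects form a set, and every nonzero object receives a nonzero morphism from a compact
object. -/
structure IsCompactlyGenerated : Prop where
  hasCoproducts : HasCoproducts.{v} K
  essentiallySmall : ObjectProperty.EssentiallySmall.{v} (compactObjects K)
  exists_ne_zero : ∀ M : K, ¬ IsZero M → ∃ (C : K) (f : C ⟶ M), compactObjects K C ∧ f ≠ 0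

end Compact

variable [HasZeroObject K] [HasShift K ℤ] [Preadditive K]
  [∀ n : ℤ, (shiftFunctor K n).Additive] [Pretriangulated K]
  [MonoidalCategory K] [SymmetricCategory K]

/-- The tensor product is exact in each variable: tensoring with a fixed object, on either side,
can be given the structure of an exact functor of triangulated categories. -/
structure IsTensorExact : Prop where
  left : ∀ M : K, ∃ _ : (tensorLeft M).CommShift ℤ, (tensorLeft M).IsTriangulated
  right : ∀ M : K, ∃ _ : (tensorRight M).CommShift ℤ, (tensorRight M).IsTriangulated

/-- A compactly generated tensor triangulated category: a triangulated category with a symmetric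
monoidal tensor product that is exact in each variable, with set indexed coproducts, compactly
generated, whose unit is compact and all of whose compact objects are rigid. -/
structure IsCompactlyGeneratedTTC : Prop where
  isTriangulated : IsTriangulated K
  tensorExact : IsTensorExact K
  compactlyGenerated : IsCompactlyGenerated K
  unit_compact : compactObjects K (𝟙_ K)
  rigid : ∀ M : K, compactObjects K M → ∃ D : K, Nonempty (ExactPairing M D)

variable {K}

section SupportData

variable {X : Type w} [TopologicalSpace X]

/-- The first five properties of a support datum, for an assignment `V` that is defined on a full
subcategory `P` of `K` and takes values in a collection `S` of subsets of `X`. Zero objects,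
the unit, coproducts, shifts and tensor products are those of `K`, whenever they lie in `P`. -/
structure SupportAxioms (P : ObjectProperty K) (S : Set (Set X)) (V : P.FullSubcategory → Set X) :
    Prop where
  mem : ∀ M, V M ∈ S
  zero : ∀ M : P.FullSubcategory, IsZero M.obj → V M = ∅
  unit : ∀ h : P (𝟙_ K), V ⟨𝟙_ K, h⟩ = Set.univ
  coproduct : ∀ (J : Type v) (M : J → P.FullSubcategory) (c : Cofan fun j => (M j).obj)
    (h : P c.pt), Nonempty (IsColimit c) → V ⟨c.pt, h⟩ = ⋃ j, V (M j)
  shift : ∀ (M : P.FullSubcategory) (h : P (M.obj⟦(1 : ℤ)⟧)), V ⟨M.obj⟦(1 : ℤ)⟧, h⟩ = V M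
  triangle : ∀ (M N Q : P.FullSubcategory) (f : M.obj ⟶ N.obj) (g : N.obj ⟶ Q.obj)
    (δ : Q.obj ⟶ M.obj⟦(1 : ℤ)⟧), Triangle.mk f g δ ∈ distTriang K → V N ⊆ V M ∪ V Q
  tensor : ∀ (M N : P.FullSubcategory) (h : P (M.obj ⊗ N.obj)),
    V ⟨M.obj ⊗ N.obj, h⟩ = V M ∩ V N

/-- A support datum on the compact objects with values in the closed subsets of `X`: besides the
first five properties, an object and its dual have the same value. -/
structure IsSupportData (V : CompactSubcategory K → Set X) : Prop
    extends SupportAxioms (compactObjects K) (closedSubsets X) V where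
  dual : ∀ M D : CompactSubcategory K, Nonempty (ExactPairing M.obj D.obj) → V M = V D

/-- Faithfulness: the value is empty exactly on the zero objects. -/
def IsFaithful {P : ObjectProperty K} (V : P.FullSubcategory → Set X) : Prop :=
  ∀ M : P.FullSubcategory, V M = ∅ ↔ IsZero M.obj

/-- An assignment on `K`, regarded as an assignment on the full subcategory of all objects. -/
def onAll (𝒱 : K → Set X) : (⊤ : ObjectProperty K).FullSubcategory → Set X := fun M => 𝒱 M.obj

/-- `𝒱`, with values in the specialization closed subsets of `X`, extends `V` to `K`. -/
structure Extends (𝒱 : K → Set X) (V : CompactSubcategory K → Set X) : Prop where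
  supportAxioms : SupportAxioms ⊤ (specializationClosedSubsets X) (onAll 𝒱)
  eq_on_compact : ∀ M : CompactSubcategory K, 𝒱 M.obj = V M
  faithful : IsFaithful V → IsFaithful (onAll 𝒱)

/-- The compact objects `N` with `V N ⊆ W`. -/
def supportIdeal (V : CompactSubcategory K → Set X) (W : Set X) : ObjectProperty K :=
  fun N => ∃ h : compactObjects K N, V ⟨N, h⟩ ⊆ W

end SupportData

/-- A thick tensor ideal of the category of compact objects: a triangulated subcategory, closed
under direct summands, and closed under tensoring with compact objects. -/
structure IsThickTensorIdeal (I : ObjectProperty K) : Prop where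
  le_compact : I ≤ compactObjects K
  triangulated : I.IsTriangulated
  summand : I.IsStableUnderRetracts
  tensor : ∀ M N : K, I M → compactObjects K N → I (M ⊗ N)

/-- The thick tensor ideal of the category of compact objects generated by a compact object `M`:
the intersection of all those that contain `M`. -/
def tensorIdeal (M : CompactSubcategory K) : ObjectProperty K :=
  fun N => ∀ I : ObjectProperty K, IsThickTensorIdeal I → I M.obj → I N

end Categories

end TensorTriangular

namespace TensorTriangular

/-! ### Compactness and finite factorization through coproducts -/

section Coproducts

variable {K : Type u} [Category.{v} K] [Preadditive K]

/-! The compact objects supported in `V M` form a thick tensor ideal containing `M`, which gives one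
inclusion. For the other, let `N` be compact and supported in `V M`, take a thick tensor ideal
containing `M`, and let `I` be its part supported in `V M`. Repeatedly coning off all morphisms from
`I` gives a tower starting at `N`. Its telescope `L` receives no nonzero morphism from `I` and is
still supported in `V M` (`exists_localization`). By rigidity, morphisms from a compact object to `M
⊗ L` correspond to morphisms from an object of `I` to `L`, so `M ⊗ L` vanishes
(`IsThickTensorIdeal.isZero_tensor`). The tensor axiom makes `𝒱 L` disjoint from `V M`, hence empty,
and faithfulness gives `L = 0`. As `N` is compact, it already dies at a finite stage of the tower
(`exists_towerMap_eq_zero`); descending the stages exhibits `N` as a retract of an object of `I`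
(`prop_of_towerMap_eq_zero`). -/

open Classical in
/-- The projection of a coproduct onto one of its summands. -/
noncomputable def cofanProj {J : Type*} {Y : J → K} {c : Cofan Y} (hc : IsColimit c) (i : J) :
    c.pt ⟶ Y i :=
  Cofan.IsColimit.desc hc fun j => if h : j = i then eqToHom (by rw [h]) else 0

@[simp]
lemma inj_cofanProj_self {J : Type*} {Y : J → K} {c : Cofan Y} (hc : IsColimit c) (i : J) :
    c.inj i ≫ cofanProj hc i = 𝟙 (Y i) := by
  simp [cofanProj]

lemma inj_cofanProj_of_ne {J : Type*} {Y : J → K} {c : Cofan Y} (hc : IsColimit c) {i j : J}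
    (h : j ≠ i) : c.inj j ≫ cofanProj hc i = 0 := by
  simp [cofanProj, h]

lemma inj_comp_sum_cofanProj {J : Type*} {Y : J → K} {c : Cofan Y} (hc : IsColimit c)
    {t : Finset J} {j : J} (hj : j ∈ t) :
    c.inj j ≫ ∑ i ∈ t, cofanProj hc i ≫ c.inj i = c.inj j := by
  rw [Preadditive.comp_sum, Finset.sum_eq_single j]
  · rw [← Category.assoc, inj_cofanProj_self, Category.id_comp]
  · intro i _ hi
    rw [← Category.assoc, inj_cofanProj_of_ne hc (Ne.symm hi), zero_comp]
  · exact fun h => absurd hj h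

/-- An object is compact if and only if every morphism to a coproduct is a finite sum of
morphisms to the summands. -/
lemma compactObjects_iff (C : K) :
    compactObjects K C ↔ ∀ (J : Type v) (Y : J → K) (c : Cofan Y), Nonempty (IsColimit c) →
      ∀ f : C ⟶ c.pt, ∃ (s : Finset J) (g : ∀ j, C ⟶ Y j), f = ∑ j ∈ s, g j ≫ c.inj j := by
  classical
  constructor
  · intro h J Y c hc f
    obtain ⟨x, hx⟩ := (h J Y c hc).2 f
    refine ⟨DFinsupp.support x, fun j => x j, ?_⟩
    rw [← hx]
    conv_lhs => rw [← DirectSum.sum_support_of x]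
    rw [map_sum]
    refine Finset.sum_congr rfl fun j _ => ?_
    simp only [DirectSum.toAddMonoid_of]
    rfl
  · rintro h J Y c ⟨hc⟩
    refine ⟨?_, fun f => ?_⟩
    · rw [injective_iff_map_eq_zero]
      intro x hx
      ext i
      have key : ∀ y : DirectSum J fun j => (C ⟶ Y j),
          (DirectSum.toAddMonoid (fun j => Preadditive.rightComp C (c.inj j)) y : C ⟶ c.pt) ≫
            cofanProj hc i = y i := by
        intro y
        induction y using DirectSum.induction_on with
        | zero => simp
        | of j y =>
          simp only [DirectSum.toAddMonoid_of]
          change (y ≫ c.inj j) ≫ _ = _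
          by_cases hj : j = i
          · subst hj
            simp
          · rw [Category.assoc, inj_cofanProj_of_ne hc hj, DirectSum.of_eq_of_ne _ _ _ (Ne.symm hj),
              comp_zero]
        | add y z hy hz => rw [map_add, Preadditive.add_comp, hy, hz, DirectSum.add_apply]
      rw [← key x]
      erw [hx]
      simp
    · obtain ⟨s, g, rfl⟩ := h J Y c ⟨hc⟩ f
      refine ⟨∑ j ∈ s, DirectSum.of (fun j => (C ⟶ Y j)) j (g j), ?_⟩
      rw [map_sum]
      refine Finset.sum_congr rfl fun j _ => ?_
      simp only [DirectSum.toAddMonoid_of]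
      rfl

/-- An object is compact if and only if every morphism `f` to a coproduct agrees with the
sum of its components over some finite set of indices. -/
lemma compactObjects_iff_exists_comp_eq (C : K) :
    compactObjects K C ↔ ∀ (J : Type v) (Y : J → K) (c : Cofan Y) (hc : IsColimit c)
      (f : C ⟶ c.pt), ∃ s : Finset J, ∀ t : Finset J, s ⊆ t →
        f ≫ ∑ j ∈ t, cofanProj hc j ≫ c.inj j = f := by
  classical
  rw [compactObjects_iff]
  constructor
  · intro h J Y c hc f
    obtain ⟨s, g, rfl⟩ := h J Y c ⟨hc⟩ f
    refine ⟨s, fun t hst => ?_⟩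
    rw [Preadditive.sum_comp]
    refine Finset.sum_congr rfl fun j hj => ?_
    rw [Category.assoc, inj_comp_sum_cofanProj hc (hst hj)]
  · rintro h J Y c ⟨hc⟩ f
    obtain ⟨s, hs⟩ := h J Y c hc f
    refine ⟨s, fun j => f ≫ cofanProj hc j, ?_⟩
    conv_lhs => rw [← hs s subset_rfl]
    simp [Preadditive.comp_sum]

instance : (compactObjects K).IsStableUnderRetracts where
  of_retract {A B} r hB := by
    rw [compactObjects_iff] at hB ⊢
    intro J Y c hc f
    obtain ⟨s, g, hg⟩ := hB J Y c hc (r.r ≫ f)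
    refine ⟨s, fun j => r.i ≫ g j, ?_⟩
    rw [← Category.id_comp f, ← r.retract, Category.assoc, hg]
    simp [Preadditive.comp_sum]

/-- A left adjoint functor whose right adjoint preserves coproducts preserves compact objects. -/
lemma compactObjects_obj_of_adjunction {F G : K ⥤ K} (adj : F ⊣ G) [F.Additive] [G.IsLeftAdjoint]
    {C : K} (hC : compactObjects K C) : compactObjects K (F.obj C) := by
  rw [compactObjects_iff] at hC ⊢
  rintro J Y c ⟨hc⟩ f
  have hGc : IsColimit (Cofan.mk (G.obj c.pt) fun j => G.map (c.inj j)) :=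
    Cofan.isColimitMapCoconeEquiv G Y c (isColimitOfPreserves G hc)
  obtain ⟨s, g, hg⟩ := hC J _ _ ⟨hGc⟩ (adj.homEquiv _ _ f)
  refine ⟨s, fun j => (adj.homEquiv _ _).symm (g j), ?_⟩
  rw [← (adj.homEquiv _ _).symm_apply_apply f, hg, adj.homEquiv_counit, F.map_sum,
    Preadditive.sum_comp]
  refine Finset.sum_congr rfl fun j _ => ?_
  rw [← adj.homEquiv_counit]
  exact adj.homEquiv_naturality_right_symm _ _

end Coproducts

/-! ### Compact objects form a triangulated subcategory -/

section Triangles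

variable {K : Type u} [Category.{v} K] [HasZeroObject K] [HasShift K ℤ] [Preadditive K]
  [∀ n : ℤ, (shiftFunctor K n).Additive] [Pretriangulated K]

/-- Subtracting from `f` a finite truncation that is exact on the first vertex leaves a morphism
factoring through the third, where a second finite set suffices; the union of both sets works for
`f`. -/
lemma compactObjects_obj₂_of_distTriang (T : Triangle K) (hT : T ∈ distTriang K)
    (h₁ : compactObjects K T.obj₁) (h₃ : compactObjects K T.obj₃) :
    compactObjects K T.obj₂ := by
  classical
  rw [compactObjects_iff_exists_comp_eq] at *
  intro J Y c hc f
  obtain ⟨s, hs⟩ := h₁ J Y c hc (T.mor₁ ≫ f)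
  obtain ⟨g, hg⟩ := T.yoneda_exact₂ hT (f - f ≫ ∑ j ∈ s, cofanProj hc j ≫ c.inj j) (by
    rw [Preadditive.comp_sub, ← Category.assoc, hs s subset_rfl, sub_self])
  obtain ⟨t, ht⟩ := h₃ J Y c hc g
  refine ⟨s ∪ t, fun t' ht' => ?_⟩
  have idem : (∑ j ∈ s, cofanProj hc j ≫ c.inj j) ≫ (∑ j ∈ t', cofanProj hc j ≫ c.inj j) =
      ∑ j ∈ s, cofanProj hc j ≫ c.inj j := by
    rw [Preadditive.sum_comp]
    refine Finset.sum_congr rfl fun j hj => ?_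
    rw [Category.assoc, inj_comp_sum_cofanProj hc (ht' (Finset.mem_union_left _ hj))]
  have hf : f = f ≫ (∑ j ∈ s, cofanProj hc j ≫ c.inj j) + T.mor₂ ≫ g := by
    rw [← hg]
    abel
  conv_lhs => rw [hf]
  rw [Preadditive.add_comp, Category.assoc, Category.assoc, idem,
    ht t' (Finset.subset_union_right.trans ht'), ← hf]

instance : (compactObjects K).IsTriangulated where
  exists_zero := by
    obtain ⟨Z, hZ⟩ := HasZeroObject.zero (C := K)
    refine ⟨Z, hZ, ?_⟩
    rw [compactObjects_iff]
    exact fun J Y c _ f => ⟨∅, fun _ => 0, hZ.eq_of_src _ _⟩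
  isStableUnderShiftBy n :=
    { le_shift := fun C hC =>
        compactObjects_obj_of_adjunction (F := shiftFunctor K n)
        (G := shiftFunctor K (-n)) (shiftEquiv K n).toAdjunction hC }
  ext₂' T hT h₁ h₃ :=
    ObjectProperty.le_isoClosure _ _ (compactObjects_obj₂_of_distTriang T hT h₁ h₃)

end Triangles

/-! ### Mapping telescopes -/

section Telescopes

variable {K : Type u} [Category.{v} K]

/-- The composite of the first `n` morphisms of a tower. -/
def towerMap {X : ℕ → K} (φ : ∀ n, X n ⟶ X (n + 1)) : ∀ n, X 0 ⟶ X n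
  | 0 => 𝟙 _
  | n + 1 => towerMap φ n ≫ φ n

/-- The endomorphism of the coproduct of a tower induced by the morphisms of the tower. -/
noncomputable def towerShift {X : ℕ → K} (φ : ∀ n, X n ⟶ X (n + 1))
    {c : Cofan fun n : ULift.{v} ℕ => X n.down} (hc : IsColimit c) : c.pt ⟶ c.pt :=
  Cofan.IsColimit.desc hc fun n => φ n.down ≫ c.inj ⟨n.down + 1⟩

variable {X : ℕ → K} {φ : ∀ n, X n ⟶ X (n + 1)}
  {c : Cofan fun n : ULift.{v} ℕ => X n.down} (hc : IsColimit c)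

lemma inj_towerShift (n : ℕ) :
    c.inj ⟨n⟩ ≫ towerShift φ hc = φ n ≫ c.inj ⟨n + 1⟩ :=
  Cofan.IsColimit.fac hc _ _

variable [Preadditive K]

lemma towerShift_cofanProj_zero : towerShift φ hc ≫ cofanProj hc ⟨0⟩ = 0 := by
  refine Cofan.IsColimit.hom_ext hc _ _ fun ⟨n⟩ => ?_
  rw [← Category.assoc, inj_towerShift, Category.assoc,
    inj_cofanProj_of_ne hc (by simp [ULift.ext_iff]), comp_zero, comp_zero]

lemma towerShift_cofanProj_succ (n : ℕ) :
    towerShift φ hc ≫ cofanProj hc ⟨n + 1⟩ = cofanProj hc ⟨n⟩ ≫ φ n := by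
  refine Cofan.IsColimit.hom_ext hc _ _ fun ⟨m⟩ => ?_
  rw [← Category.assoc, inj_towerShift, Category.assoc]
  by_cases h : m = n
  · subst h
    rw [inj_cofanProj_self, ← Category.assoc, inj_cofanProj_self, Category.comp_id,
      Category.id_comp]
  · rw [inj_cofanProj_of_ne hc (by simpa [ULift.ext_iff] using h), ← Category.assoc,
      inj_cofanProj_of_ne hc (by simpa [ULift.ext_iff] using h), comp_zero, zero_comp]

/-- If the telescope of a tower with compact bottom vanishes, some composite of morphisms of the
tower that starts at the bottom vanishes. -/
lemma exists_towerMap_eq_zero (hX : compactObjects K (X 0))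
    [IsIso (𝟙 c.pt - towerShift φ hc)] : ∃ n, towerMap φ n = 0 := by
  -- The equation `a - a ≫ towerShift φ hc = c.inj ⟨0⟩` forces the components of `a` recursively to
  -- be the composites `towerMap φ n`; by compactness almost all of them vanish.
  let a : X 0 ⟶ c.pt := c.inj ⟨0⟩ ≫ inv (𝟙 c.pt - towerShift φ hc)
  have ha : a - a ≫ towerShift φ hc = c.inj ⟨0⟩ := by
    have : a ≫ (𝟙 c.pt - towerShift φ hc) = c.inj ⟨0⟩ := by
      rw [Category.assoc, IsIso.inv_hom_id, Category.comp_id]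
    rwa [Preadditive.comp_sub, Category.comp_id] at this
  have hcomp : ∀ n, a ≫ cofanProj hc ⟨n⟩ = towerMap φ n := by
    intro n
    induction n with
    | zero =>
      have := congrArg (· ≫ cofanProj hc ⟨0⟩) ha
      simpa only [Preadditive.sub_comp, Category.assoc, towerShift_cofanProj_zero, comp_zero,
        sub_zero, inj_cofanProj_self, towerMap] using this
    | succ n ih =>
      have := congrArg (· ≫ cofanProj hc ⟨n + 1⟩) ha
      simp only [Preadditive.sub_comp, Category.assoc, towerShift_cofanProj_succ] at this
      rw [inj_cofanProj_of_ne hc (by simp [ULift.ext_iff]), sub_eq_zero, ← Category.assoc, ih]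
        at this
      exact this
  obtain ⟨s, g, hg⟩ := (compactObjects_iff _).1 hX _ _ c ⟨hc⟩ a
  obtain ⟨⟨n⟩, hn⟩ := Infinite.exists_notMem_finset s
  refine ⟨n, ?_⟩
  rw [← hcomp, hg, Preadditive.sum_comp]
  refine Finset.sum_eq_zero fun j hj => ?_
  have hjn : j ≠ ⟨n⟩ := fun h => hn (h ▸ hj)
  rw [Category.assoc, inj_cofanProj_of_ne hc hjn, comp_zero]

end Telescopes

/-! ### Cell attachments and Neeman-style localization -/

section Towers

variable {K : Type u} [Category.{v} K] [HasZeroObject K] [HasShift K ℤ] [Preadditive K]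
  [∀ n : ℤ, (shiftFunctor K n).Additive] [Pretriangulated K]

/-- A morphism is a cell attachment for `I` if its fibre is a coproduct of objects of `I` and it
annihilates all morphisms from objects of `I`. -/
def IsCellAttachment (I : ObjectProperty K) {X X' : K} (φ : X ⟶ X') : Prop :=
  (∀ (C : K) (f : C ⟶ X), I C → f ≫ φ = 0) ∧
    ∃ (J : Type v) (Y : J → K) (c : Cofan Y) (p : c.pt ⟶ X) (δ : X' ⟶ c.pt⟦(1 : ℤ)⟧),
      (∀ j, I (Y j)) ∧ Nonempty (IsColimit c) ∧ Triangle.mk p φ δ ∈ distTriang K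

lemma exists_isCellAttachment (I : ObjectProperty K) [ObjectProperty.EssentiallySmall.{v} I]
    [HasCoproducts.{v} K] (X : K) : ∃ (X' : K) (φ : X ⟶ X'), IsCellAttachment I φ := by
  obtain ⟨Q, hQ, hQI, hIQ⟩ := ObjectProperty.EssentiallySmall.exists_small_le.{v} I
  let S : Type v := Shrink.{v} (Subtype Q)
  let A : S → K := fun s => ((equivShrink (Subtype Q)).symm s).1
  let Y : (Σ s : S, (A s ⟶ X)) → K := fun j => A j.1
  let p : ∐ Y ⟶ X := Sigma.desc fun j => j.2
  obtain ⟨X', φ, δ, hT⟩ := distinguished_cocone_triangle p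
  refine ⟨X', φ, ?_, _, Y, Cofan.mk (∐ Y) (Sigma.ι Y), p, δ, ?_, ⟨coproductIsCoproduct Y⟩, hT⟩
  · intro C f hC
    obtain ⟨B, hB, ⟨e⟩⟩ := hIQ C hC
    obtain ⟨s, hs⟩ := (equivShrink (Subtype Q)).symm.surjective ⟨B, hB⟩
    have hA : A s = B := congrArg Subtype.val hs
    subst hA
    -- The family runs over all morphisms from representatives of `I`, so `f` is one of them up to
    -- isomorphism.
    have h : f = e.hom ≫ Sigma.ι Y ⟨s, e.inv ≫ f⟩ ≫ p := by
      simp [p]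
    have h₀ : p ≫ φ = 0 := comp_distTriang_mor_zero₁₂ _ hT
    rw [h, Category.assoc, Category.assoc, h₀, comp_zero, comp_zero]
  · exact fun j => hQI _ ((equivShrink (Subtype Q)).symm j.1).2

/-- Every object is the bottom of a tower of cell attachments. -/
lemma exists_tower (I : ObjectProperty K) [ObjectProperty.EssentiallySmall.{v} I]
    [HasCoproducts.{v} K] (N : K) :
    ∃ (X : ℕ → K) (φ : ∀ n, X n ⟶ X (n + 1)), X 0 = N ∧ ∀ n, IsCellAttachment I (φ n) := by
  choose next φ hφ using exists_isCellAttachment I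
  exact ⟨fun n => Nat.rec N (fun _ => next) n, fun n => φ _, rfl, fun n => hφ _⟩

/-- The telescope of a tower is right orthogonal to the compact objects from which all morphisms
to the tower die at the next stage. -/
lemma eq_zero_of_tower {X : ℕ → K} {φ : ∀ n, X n ⟶ X (n + 1)}
    {c : Cofan fun n : ULift.{v} ℕ => X n.down} (hc : IsColimit c) {I : ObjectProperty K} [I.IsStableUnderShift ℤ]
    (hI : I ≤ compactObjects K) (h : ∀ n (C : K) (f : C ⟶ X n), I C → f ≫ φ n = 0)
    {L : K} {π : c.pt ⟶ L} {δ : L ⟶ c.pt⟦(1 : ℤ)⟧}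
    (hT : Triangle.mk (𝟙 c.pt - towerShift φ hc) π δ ∈ distTriang K)
    {C : K} (hC : I C) (f : C ⟶ L) : f = 0 := by
  have kill : ∀ (B : K) (g : B ⟶ c.pt), I B → g ≫ towerShift φ hc = 0 := by
    intro B g hB
    obtain ⟨s, k, rfl⟩ := (compactObjects_iff B).1 (hI B hB) _ _ c ⟨hc⟩ g
    rw [Preadditive.sum_comp]
    refine Finset.sum_eq_zero fun ⟨n⟩ _ => ?_
    rw [Category.assoc, inj_towerShift, ← Category.assoc, h n B _ hB, zero_comp]
  -- Transposing to `C⟦-1⟧`, still in `I`, shows that the shifted `towerShift` kills `f ≫ δ`. So the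
  -- shift of `𝟙 - towerShift` acts on it as the identity, yet also gives zero.
  have hδ : f ≫ δ = 0 := by
    let adj : shiftFunctor K (-1 : ℤ) ⊣ shiftFunctor K (1 : ℤ) :=
      (shiftEquiv K (1 : ℤ)).symm.toAdjunction
    have h₀ : (f ≫ δ) ≫ (towerShift φ hc)⟦(1 : ℤ)⟧' = 0 := by
      rw [← (adj.homEquiv _ _).apply_symm_apply (f ≫ δ), ← adj.homEquiv_naturality_right,
        kill _ _ (I.le_shift (-1) _ hC), adj.homEquiv_unit, Functor.map_zero, comp_zero]
    have h₁ : δ ≫ (𝟙 c.pt - towerShift φ hc)⟦(1 : ℤ)⟧' = 0 := comp_distTriang_mor_zero₃₁ _ hT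
    have h₂ : (f ≫ δ) ≫ (𝟙 c.pt - towerShift φ hc)⟦(1 : ℤ)⟧' = 0 := by
      rw [Category.assoc, h₁, comp_zero]
    rw [Functor.map_sub, Preadditive.comp_sub, h₀, sub_zero, CategoryTheory.Functor.map_id] at h₂
    exact (Category.comp_id _).symm.trans h₂
  obtain ⟨g, hg⟩ : ∃ g : C ⟶ c.pt, f = g ≫ π := Triangle.coyoneda_exact₃ _ hT f hδ
  have hg' : g = g ≫ (𝟙 c.pt - towerShift φ hc) := by
    rw [Preadditive.comp_sub, kill C g hC, sub_zero, Category.comp_id]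
  have hπ : (𝟙 c.pt - towerShift φ hc) ≫ π = 0 := comp_distTriang_mor_zero₁₂ _ hT
  rw [hg, hg', Category.assoc, hπ, comp_zero]

lemma compactObjects_of_trW {I : ObjectProperty K} (hI : I ≤ compactObjects K) {A B : K} {s : A ⟶ B} (hs : I.trW s)
    (hB : compactObjects K B) : compactObjects K A := by
  obtain ⟨Z, g, h, hT, hZ⟩ := hs
  exact (compactObjects K).ext_of_isTriangulatedClosed₁ _ hT hB (hI _ hZ)

variable [IsTriangulated K] (I : ObjectProperty K) [I.IsTriangulated]

/-- Finitely many morphisms to objects of `I` are annihilated by a single morphism with cone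
in `I`. -/
lemma exists_trW_comp_eq_zero {J : Type*} {Y : J → K} (hY : ∀ j, I (Y j)) {A : K}
    (g : ∀ j, A ⟶ Y j) (s : Finset J) :
    ∃ (A' : K) (t : A' ⟶ A), I.trW t ∧ ∀ j ∈ s, t ≫ g j = 0 := by
  classical
  induction s using Finset.induction_on with
  | empty => exact ⟨A, 𝟙 A, I.trW.id_mem A, by simp⟩
  | insert i s _ ih =>
    obtain ⟨A', t, ht, hts⟩ := ih
    -- The fibre kills the new morphism, and its cone `Y i` lies in `I`; composites keep cones in
    -- `I` by the octahedral axiom.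
    obtain ⟨B, b, δ, hT⟩ := distinguished_cocone_triangle₁ (t ≫ g i)
    have hb : b ≫ t ≫ g i = 0 := comp_distTriang_mor_zero₁₂ _ hT
    refine ⟨B, b ≫ t, I.trW.comp_mem _ _ (ObjectProperty.trW.mk I hT (hY i)) ht, ?_⟩
    intro j hj
    rcases Finset.mem_insert.1 hj with rfl | hj
    · rw [Category.assoc, hb]
    · rw [Category.assoc, hts j hj, comp_zero]

/-- A morphism from a compact object that becomes zero in a tower of cell attachments is
annihilated by a morphism with cone in `I`. -/
lemma exists_trW_comp_eq_zero_of_tower (hI : I ≤ compactObjects K) {X : ℕ → K}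
    {φ : ∀ n, X n ⟶ X (n + 1)} (hφ : ∀ n, IsCellAttachment I (φ n)) (n : ℕ) :
    ∀ {A : K} (_ : compactObjects K A) (a : A ⟶ X 0), a ≫ towerMap φ n = 0 →
      ∃ (A' : K) (t : A' ⟶ A), I.trW t ∧ t ≫ a = 0 := by
  induction n with
  | zero =>
    intro A _ a ha
    exact ⟨A, 𝟙 A, I.trW.id_mem A, by simpa [towerMap] using ha⟩
  | succ n ih =>
    intro A hA a ha
    obtain ⟨-, J, Y, c, p, δ, hY, ⟨hc⟩, hT⟩ := hφ n
    -- A morphism killed by the last stage lifts to its fibre, where only finitely many cells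
    -- matter; killing those lowers `n`.
    obtain ⟨b, hb⟩ : ∃ b : A ⟶ c.pt, a ≫ towerMap φ n = b ≫ p :=
      Triangle.coyoneda_exact₂ _ hT _ ((Category.assoc _ _ _).trans ha)
    obtain ⟨s, g, rfl⟩ := (compactObjects_iff A).1 hA _ _ c ⟨hc⟩ b
    obtain ⟨A', t, ht, hts⟩ := exists_trW_comp_eq_zero I hY g s
    obtain ⟨A'', t', ht', h⟩ := ih (compactObjects_of_trW hI ht hA) (t ≫ a) (by
      rw [Category.assoc, hb, ← Category.assoc, Preadditive.comp_sum, Finset.sum_eq_zero,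
        zero_comp]
      intro j hj
      rw [← Category.assoc, hts j hj, zero_comp])
    exact ⟨A'', t' ≫ t, I.trW.comp_mem _ _ ht' ht, by rw [Category.assoc, h]⟩

/-- Applied to the identity of `X 0`, the descent gives a zero morphism into `X 0` with cone in `I`;
then `X 0` is a retract of that cone. -/
lemma prop_of_towerMap_eq_zero [I.IsStableUnderRetracts] (hI : I ≤ compactObjects K)
    {X : ℕ → K} {φ : ∀ n, X n ⟶ X (n + 1)} (hφ : ∀ n, IsCellAttachment I (φ n))
    (hX : compactObjects K (X 0)) {n : ℕ} (hn : towerMap φ n = 0) : I (X 0) := by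
  obtain ⟨A, t, ⟨Z, g, h, hT, hZ⟩, ht⟩ :=
    exists_trW_comp_eq_zero_of_tower I hI hφ n hX (𝟙 _) (by rw [hn, comp_zero])
  obtain ⟨r, hr⟩ := Triangle.yoneda_exact₂ _ hT (𝟙 (X 0)) ht
  exact I.prop_of_retract ⟨g, r, hr.symm⟩ hZ

/-- Let `I` be a thick subcategory of compact objects and `N` a compact object. A localizing
subcategory that contains `I` and `N` contains an object `L` that is right orthogonal to `I` and
whose vanishing implies that `N` lies in `I`. -/
theorem exists_localization [I.IsStableUnderRetracts] [ObjectProperty.EssentiallySmall.{v} I]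
    [HasCoproducts.{v} K] (hI : I ≤ compactObjects K)
    (𝓛 : ObjectProperty K) [𝓛.IsTriangulated] [𝓛.IsClosedUnderIsomorphisms]
    (h𝓛 : ∀ (J : Type v) (Y : J → K) (c : Cofan Y), IsColimit c → (∀ j, 𝓛 (Y j)) → 𝓛 c.pt)
    (hI𝓛 : I ≤ 𝓛) {N : K} (hN : compactObjects K N) (hN𝓛 : 𝓛 N) :
    ∃ L : K, 𝓛 L ∧ (∀ (C : K) (f : C ⟶ L), I C → f = 0) ∧ (IsZero L → I N) := by
  obtain ⟨X, φ, rfl, hφ⟩ := exists_tower I N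
  have hX : ∀ n, 𝓛 (X n) := by
    intro n
    induction n with
    | zero => exact hN𝓛
    | succ n ih =>
      obtain ⟨-, J, Y, c, p, δ, hY, ⟨hc⟩, hT⟩ := hφ n
      exact 𝓛.ext_of_isTriangulatedClosed₃ _ hT (h𝓛 J Y c hc fun j => hI𝓛 _ (hY j)) ih
  let Y : ULift.{v} ℕ → K := fun n => X n.down
  let c : Cofan Y := Cofan.mk (∐ Y) (Sigma.ι Y)
  have hc : IsColimit c := coproductIsCoproduct Y
  obtain ⟨L, π, δ, hT⟩ := distinguished_cocone_triangle (𝟙 c.pt - towerShift φ hc)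
  have hc𝓛 : 𝓛 c.pt := h𝓛 _ Y c hc fun n => hX n.down
  refine ⟨L, 𝓛.ext_of_isTriangulatedClosed₃ _ hT hc𝓛 hc𝓛,
    fun C f hC => eq_zero_of_tower hc hI (fun n C f => (hφ n).1 C f) hT hC f, fun hL => ?_⟩
  have : IsIso (𝟙 c.pt - towerShift φ hc) := (Triangle.isZero₃_iff_isIso₁ _ hT).1 hL
  obtain ⟨n, hn⟩ := exists_towerMap_eq_zero (φ := φ) hc hN
  exact prop_of_towerMap_eq_zero I hI hφ hN hn

end Towers

/-! ### Rigid objects and duality -/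

section Rigid

variable {K : Type u} [Category.{v} K] [HasZeroObject K] [HasShift K ℤ] [Preadditive K]
  [∀ n : ℤ, (shiftFunctor K n).Additive] [Pretriangulated K]
  [MonoidalCategory K]

lemma IsTensorExact.tensorLeft_additive (h : IsTensorExact K) (M : K) :
    (tensorLeft M).Additive := by
  obtain ⟨_, _⟩ := h.left M
  infer_instance

variable [SymmetricCategory K]

/-- Tensoring with a rigid object preserves compact objects. -/
lemma compactObjects_tensor_of_exactPairing (h : IsTensorExact K) (M D : K) [ExactPairing M D]
    {C : K} (hC : compactObjects K C) : compactObjects K (D ⊗ C) := by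
  have : ExactPairing D M := BraidedCategory.exactPairing_swap M D
  have := h.tensorLeft_additive D
  have : (tensorLeft M).IsLeftAdjoint := (tensorLeftAdjunction D M).isLeftAdjoint
  exact compactObjects_obj_of_adjunction (tensorLeftAdjunction M D) hC

lemma compactObjects_dual (h : IsTensorExact K) (h₁ : compactObjects K (𝟙_ K)) (M D : K)
    [ExactPairing M D] : compactObjects K D :=
  (compactObjects K).prop_of_iso (ρ_ D) (compactObjects_tensor_of_exactPairing h M D h₁)

/-- The dual of an object that lies in a thick tensor ideal lies in that ideal. -/
lemma IsThickTensorIdeal.dual_mem {I : ObjectProperty K} (hI : IsThickTensorIdeal I) {M D : K}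
    [ExactPairing M D] (hD : compactObjects K D) (hM : I M) : I D := by
  have := hI.summand
  have h : I ((D ⊗ M) ⊗ D) := hI.tensor _ _ (I.prop_of_iso (β_ M D) (hI.tensor M D hM hD)) hD
  refine I.prop_of_retract (Y := (D ⊗ M) ⊗ D)
    ⟨(ρ_ D).inv ≫ D ◁ η_ M D ≫ (α_ D M D).inv, ε_ M D ▷ D ≫ (λ_ D).hom, ?_⟩ h
  have := ExactPairing.coevaluation_evaluation M D
  simp only [Category.assoc]
  rw [reassoc_of% this]
  simp

/-- An object that is right orthogonal to a thick tensor ideal is annihilated by the rigid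
objects of the ideal. -/
lemma IsThickTensorIdeal.isZero_tensor (hK : IsCompactlyGeneratedTTC K) {I : ObjectProperty K}
    (hI : IsThickTensorIdeal I) {M L : K} (hM : I M)
    (hL : ∀ (C : K) (f : C ⟶ L), I C → f = 0) : IsZero (M ⊗ L) := by
  by_contra h
  obtain ⟨C, f, hC, hf⟩ := hK.compactlyGenerated.exists_ne_zero _ h
  obtain ⟨D, ⟨_⟩⟩ := hK.rigid M (hI.le_compact M hM)
  have hD := compactObjects_dual hK.tensorExact hK.unit_compact M D
  have hDC : I (D ⊗ C) := hI.tensor D C (hI.dual_mem hD hM) hC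
  -- The transposes of `f` and of `0` both start at `D ⊗ C`, so both vanish; additivity of the
  -- bijection is not needed.
  exact hf ((tensorLeftHomEquiv C M D L).symm.injective
    ((hL _ _ hDC).trans (hL _ _ hDC).symm))

end Rigid

/-! ### Supports and the comparison of ideals -/

section Support

variable {K : Type u} [Category.{v} K] [HasZeroObject K] [HasShift K ℤ] [Preadditive K]
  [∀ n : ℤ, (shiftFunctor K n).Additive] [Pretriangulated K]
  [MonoidalCategory K]
  {X : Type w} {S : Set (Set X)} {𝒱 : K → Set X}

/-- The objects of `K` whose support is contained in `W`. -/
def supportedObjects (𝒱 : K → Set X) (W : Set X) : ObjectProperty K := fun N => 𝒱 N ⊆ W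

lemma SupportAxioms.coproduct_eq (h : SupportAxioms ⊤ S (onAll 𝒱)) {J : Type v} (Y : J → K)
    (c : Cofan Y) (hc : IsColimit c) : 𝒱 c.pt = ⋃ j, 𝒱 (Y j) :=
  h.coproduct J (fun j => ⟨Y j, trivial⟩) c trivial ⟨hc⟩

/-- Isomorphism invariance follows from the coproduct axiom: `B` is a coproduct of the one-member
family `A`. -/
lemma SupportAxioms.eq_of_iso (h : SupportAxioms ⊤ S (onAll 𝒱)) {A B : K} (e : A ≅ B) :
    𝒱 A = 𝒱 B := by
  have := h.coproduct_eq (J := PUnit) (fun _ => A) _ (Cofan.isColimitMkOfUnique e PUnit)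
  exact (this.trans (Set.iUnion_const _)).symm

lemma SupportAxioms.tensor_eq (h : SupportAxioms ⊤ S (onAll 𝒱)) (A B : K) :
    𝒱 (A ⊗ B) = 𝒱 A ∩ 𝒱 B :=
  h.tensor ⟨A, trivial⟩ ⟨B, trivial⟩ trivial

lemma SupportAxioms.shift_one_eq (h : SupportAxioms ⊤ S (onAll 𝒱)) (A : K) :
    𝒱 (A⟦(1 : ℤ)⟧) = 𝒱 A :=
  h.shift ⟨A, trivial⟩ trivial

lemma SupportAxioms.shift_eq (h : SupportAxioms ⊤ S (onAll 𝒱)) (A : K) (n : ℤ) :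
    𝒱 (A⟦n⟧) = 𝒱 A := by
  have step (m : ℤ) : 𝒱 (A⟦m + 1⟧) = 𝒱 (A⟦m⟧) := by
    rw [h.eq_of_iso ((shiftFunctorAdd K m 1).app A)]
    exact h.shift_one_eq _
  induction n using Int.induction_on with
  | zero => exact h.eq_of_iso ((shiftFunctorZero K ℤ).app A)
  | succ n ih => rw [step, ih]
  | pred n ih => rw [← ih, ← step, sub_add_cancel]

/-- The support of a retract is contained in the support of the object. -/
lemma SupportAxioms.subset_of_retract (h : SupportAxioms ⊤ S (onAll 𝒱)) {A B : K}
    (r : Retract A B) : 𝒱 A ⊆ 𝒱 B := by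
  -- The cone of the section is a complement: `B` is the coproduct of `A` and `C`, so the coproduct
  -- axiom applies.
  obtain ⟨C, g, δ, hT⟩ := distinguished_cocone_triangle r.i
  have hri : r.i ≫ r.r = 𝟙 A := r.retract
  have hig : r.i ≫ g = 0 := comp_distTriang_mor_zero₁₂ _ hT
  have : Mono r.i := mono_of_mono_fac hri
  have hδ : δ = 0 := Triangle.mor₃_eq_zero_of_mono₁ _ hT this
  have : Epi g := Triangle.epi₂ _ hT hδ
  obtain ⟨s, hs⟩ : ∃ s : C ⟶ B, 𝟙 B - r.r ≫ r.i = g ≫ s :=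
    Triangle.yoneda_exact₂ _ hT _ (by
      change r.i ≫ (𝟙 B - r.r ≫ r.i) = 0
      rw [Preadditive.comp_sub, ← Category.assoc, hri, Category.comp_id, Category.id_comp,
        sub_self])
  have hsg : s ≫ g = 𝟙 C := by
    rw [← cancel_epi g, ← Category.assoc, ← hs, Preadditive.sub_comp, Category.assoc, hig]
    simp
  have hsr : s ≫ r.r = 0 := by
    rw [← cancel_epi g, ← Category.assoc, ← hs, Preadditive.sub_comp, Category.assoc, hri]
    simp
  let Y : ULift.{v} Bool → K := fun j => Bool.rec C A j.down
  let c : Cofan Y := Cofan.mk B fun j => match j with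
    | ⟨true⟩ => r.i
    | ⟨false⟩ => s
  have hc : IsColimit c := Cofan.IsColimit.mk c
    (fun t => r.r ≫ t.inj ⟨true⟩ + g ≫ t.inj ⟨false⟩)
    (by
      rintro t ⟨_ | _⟩
      · change s ≫ (r.r ≫ t.inj ⟨true⟩ + g ≫ t.inj ⟨false⟩) = t.inj ⟨false⟩
        rw [Preadditive.comp_add, reassoc_of% hsr, reassoc_of% hsg, zero_comp, zero_add]
      · change r.i ≫ (r.r ≫ t.inj ⟨true⟩ + g ≫ t.inj ⟨false⟩) = t.inj ⟨true⟩
        rw [Preadditive.comp_add, reassoc_of% hri, reassoc_of% hig, zero_comp, add_zero])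
    (by
      intro t m hm
      have h₁ : r.i ≫ m = t.inj ⟨true⟩ := hm ⟨true⟩
      have h₂ : s ≫ m = t.inj ⟨false⟩ := hm ⟨false⟩
      rw [← h₁, ← h₂, ← Category.assoc, ← Category.assoc, ← hs, Preadditive.sub_comp,
        add_sub_cancel]
      exact (Category.id_comp _).symm)
  have hB : 𝒱 B = ⋃ j, 𝒱 (Y j) := h.coproduct_eq Y c hc
  rw [hB]
  exact Set.subset_iUnion (fun j => 𝒱 (Y j)) ⟨true⟩

lemma SupportAxioms.isStableUnderRetracts_supportedObjects (h : SupportAxioms ⊤ S (onAll 𝒱))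
    (W : Set X) : (supportedObjects 𝒱 W).IsStableUnderRetracts where
  of_retract r hB := (h.subset_of_retract r).trans hB

lemma SupportAxioms.isTriangulated_supportedObjects (h : SupportAxioms ⊤ S (onAll 𝒱))
    (W : Set X) : (supportedObjects 𝒱 W).IsTriangulated where
  exists_zero := by
    obtain ⟨Z, hZ⟩ := HasZeroObject.zero (C := K)
    exact ⟨Z, hZ, (h.zero ⟨Z, trivial⟩ hZ).trans_subset (Set.empty_subset W)⟩
  isStableUnderShiftBy n := { le_shift := fun A hA => (h.shift_eq A n).trans_subset hA }
  ext₂' T hT h₁ h₃ := ObjectProperty.le_isoClosure _ _ <|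
    (h.triangle ⟨T.obj₁, trivial⟩ ⟨T.obj₂, trivial⟩ ⟨T.obj₃, trivial⟩ T.mor₁ T.mor₂ T.mor₃
      hT).trans (Set.union_subset h₁ h₃)

variable [TopologicalSpace X]

lemma Extends.supportIdeal_eq {V : CompactSubcategory K → Set X} (h : Extends 𝒱 V) (W : Set X) :
    supportIdeal V W = compactObjects K ⊓ supportedObjects 𝒱 W := by
  ext N
  constructor
  · rintro ⟨hN, hW⟩
    exact ⟨hN, (h.eq_on_compact ⟨N, hN⟩).trans_subset hW⟩
  · rintro ⟨hN, hW⟩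
    exact ⟨hN, (h.eq_on_compact ⟨N, hN⟩).symm.trans_subset hW⟩

variable [SymmetricCategory K]

lemma Extends.isThickTensorIdeal_supportIdeal (hK : IsCompactlyGeneratedTTC K)
    {V : CompactSubcategory K → Set X} (h : Extends 𝒱 V) (W : Set X) :
    IsThickTensorIdeal (supportIdeal V W) := by
  have := h.supportAxioms.isStableUnderRetracts_supportedObjects W
  have := h.supportAxioms.isTriangulated_supportedObjects W
  rw [h.supportIdeal_eq]
  refine ⟨inf_le_left, inferInstance, ⟨fun r hB => ?_⟩, fun A B hA hB => ⟨?_, ?_⟩⟩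
  · exact ⟨(compactObjects K).prop_of_retract r hB.1,
      (supportedObjects 𝒱 W).prop_of_retract r hB.2⟩
  · obtain ⟨D, ⟨_⟩⟩ := hK.rigid A hA.1
    have : ExactPairing D A := BraidedCategory.exactPairing_swap A D
    exact compactObjects_tensor_of_exactPairing hK.tensorExact D A hB
  · exact (h.supportAxioms.tensor_eq A B).trans_subset (Set.inter_subset_left.trans hA.2)

/-- A thick tensor ideal that contains `M` contains all compact objects supported in the support
of `M`. -/
lemma Extends.supportIdeal_le (hK : IsCompactlyGeneratedTTC K)
    {V : CompactSubcategory K → Set X} (hV : IsFaithful V) (h : Extends 𝒱 V)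
    (M : CompactSubcategory K) : supportIdeal V (V M) ≤ tensorIdeal M := by
  intro N hN I' hI' hM'
  -- Without the intersection, the attached cells, and hence `L`, might have support outside `V M`.
  let I : ObjectProperty K := I' ⊓ supportIdeal V (V M)
  have hS := h.isThickTensorIdeal_supportIdeal hK (V M)
  have := hI'.triangulated
  have := hI'.summand
  have := hS.triangulated
  have := hS.summand
  have hI : IsThickTensorIdeal I :=
    { le_compact := inf_le_left.trans hI'.le_compact
      triangulated := inferInstance
      summand := ⟨fun r hB => ⟨I'.prop_of_retract r hB.1, ObjectProperty.prop_of_retract _ r hB.2⟩⟩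
      tensor := fun A B hA hB => ⟨hI'.tensor A B hA.1 hB, hS.tensor A B hA.2 hB⟩ }
  have hM : I M.obj := ⟨hM', M.property, subset_rfl⟩
  have := hI.triangulated
  have := hI.summand
  have := hK.isTriangulated
  have := hK.compactlyGenerated.hasCoproducts
  have := hK.compactlyGenerated.essentiallySmall
  have : ObjectProperty.EssentiallySmall.{v} I :=
    ObjectProperty.EssentiallySmall.of_le hI.le_compact
  have := h.supportAxioms.isStableUnderRetracts_supportedObjects (V M)
  have := h.supportAxioms.isTriangulated_supportedObjects (V M)
  rw [h.supportIdeal_eq] at hN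
  obtain ⟨L, hLW, hL, hLN⟩ := exists_localization I hI.le_compact (supportedObjects 𝒱 (V M))
    (fun J Y c hc hY => (h.supportAxioms.coproduct_eq Y c hc).trans_subset (Set.iUnion_subset hY))
    (inf_le_right.trans ((h.supportIdeal_eq (V M)).trans_le inf_le_right)) hN.1 hN.2
  refine (hLN ((h.faithful hV ⟨L, trivial⟩).1 ?_)).1
  have hML : 𝒱 (M.obj ⊗ L) = ∅ :=
    (h.faithful hV ⟨M.obj ⊗ L, trivial⟩).2 (hI.isZero_tensor hK hM hL)
  rw [h.supportAxioms.tensor_eq, h.eq_on_compact] at hML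
  exact (Set.inter_eq_right.2 hLW).symm.trans hML

end Support

end TensorTriangular

theorem theoremT {K : Type u} [Category.{v} K] [HasZeroObject K] [HasShift K ℤ] [Preadditive K]
    [∀ n : ℤ, (shiftFunctor K n).Additive] [Pretriangulated K]
    [MonoidalCategory K] [SymmetricCategory K]
    (hK : TensorTriangular.IsCompactlyGeneratedTTC K)
    {X : Type w} [TopologicalSpace X] (hX : TensorTriangular.IsZariskiSpace X)
    (V : TensorTriangular.CompactSubcategory K → Set X)
    (hV : TensorTriangular.IsSupportData V)
    (hfaithful : TensorTriangular.IsFaithful V)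
    (𝒱 : K → Set X) (hext : TensorTriangular.Extends 𝒱 V)
    (M : TensorTriangular.CompactSubcategory K) :
    TensorTriangular.supportIdeal V (V M) = TensorTriangular.tensorIdeal M :=
  le_antisymm (hext.supportIdeal_le hK hfaithful M) fun _ hN =>
    hN _ (hext.isThickTensorIdeal_supportIdeal hK (V M)) ⟨M.property, subset_rfl⟩
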